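/- Let $X$ and $Y$ be real Fréchet spaces and let $\Phi:X\times Y\to\overline{\mathbb R}=\mathbb R\cup\{\pm\infty\}$ be proper (i.e. $\operatorname{dom}\Phi=\{\Phi<+\infty\}\neq\emptyset$ and $\Phi>-\infty$ everywhere), convex and lower semicontinuous. Put $v(P_\Phi)=\inf_{x\in X}\Phi(x,0)$, let $\operatorname{pr}_Y$ and $\operatorname{pr}_{Y\times\mathbb R}$ denote the projections of $X\times Y$ onto $Y$ and of $X\times Y\times\mathbb R$ onto $Y\times\mathbb R$, and let $\operatorname{epi}f=\{(z,r): f(z)\le r\}$ be the epigraph of $f$. For a convex subset $U$ of a locally convex space $E$ write $\operatorname{cone}(U)=\bigcup_{t\ge 0}tU$ and $$\operatorname{core}(U)=\{x\in U:\operatorname{cone}(U-x)=E\},\qquad \operatorname{qi}(U)=\{x\in U:\operatorname{cl}(\operatorname{cone}(U-x))=E\},$$ $$\operatorname{qri}(U)=\{x\in U:\operatorname{cl}(\operatorname{cone}(U-x))\text{ is a linear subspace of }E\}.$$ Consider the conditions - $(RC_1)$: there is $x'\in X$ with $(x',0)\in\operatorname{dom}\Phi$ such that $\Phi(x',\cdot)$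 is continuous at $0$; - $(RC_2)$: $X,Y$ are Fréchet spaces, $\Phi$ is lower semicontinuous and $0\in\operatorname{int}(\operatorname{pr}_Y(\operatorname{dom}\Phi))$; - $(RC_3)$: $X,Y$ are Fréchet spaces, $\Phi$ is lower semicontinuous and $0\in\operatorname{core}(\operatorname{pr}_Y(\operatorname{dom}\Phi))$; - $(RC_6)$: $0\in\operatorname{qi}(\operatorname{pr}_Y(\operatorname{dom}\Phi))$ and $(0,0)\notin\operatorname{qri}\big[\operatorname{co}\big(\operatorname{pr}_{Y\times\mathbb R}(\operatorname{epi}(\Phi-v(P_\Phi)))\cup\{(0,0)\}\big)\big]$; - $(RC_7)$: $0\in\operatorname{qi}\big[\operatorname{pr}_Y(\operatorname{dom}\Phi)-\operatorname{pr}_Y(\operatorname{dom}\Phi)\big]$, $0\in\operatorname{qri}(\operatorname{pr}_Y(\operatorname{dom}\Phi))$ and $(0,0)\notin\operatorname{qri}\big[\operatorname{co}\big(\operatorname{pr}_{Y\times\mathbb R}(\operatorname{epi}(\Phi-v(P_\Phi)))\cup\{(0,0)\}\big)\big]$. Then $(RC_1)\Rightarrow(RC_2)\Leftrightarrow(RC_3)$.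 If moreover $v(P_\Phi)>-\infty$, then also $(RC_3)\Rightarrow(RC_6)\Leftrightarrow(RC_7)$. -/

import Mathlib

open scoped Pointwise

namespace ConvexDuality

/-- A (real) Fréchet space: a locally convex topological vector space that is metrizable (hence
Hausdorff) and complete. The uniformity is the one of the additive topological group `E`. -/
class FrechetSpace (E : Type*) [AddCommGroup E] [Module ℝ E] [UniformSpace E] : Prop extends
  IsUniformAddGroup E, ContinuousSMul ℝ E, LocallyConvexSpace ℝ E, CompleteSpace E,
  TopologicalSpace.MetrizableSpace E

section Functions

variable {E : Type*}

/-- The (effective) domain of an extended real valued function. -/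
def dom (f : E → EReal) : Set E := {x | f x < ⊤}

/-- The epigraph of an extended real valued function. -/
def epi (f : E → EReal) : Set (E × ℝ) := {p | f p.1 ≤ (p.2 : EReal)}

/-- Proper: the domain is nonempty and the value `-∞` is not taken. -/
def Proper (f : E → EReal) : Prop := (dom f).Nonempty ∧ ∀ x, ⊥ < f x

/-- Addition on the extended reals with the convention `(+∞) + (-∞) = +∞`. -/
noncomputable def upperAdd (a b : EReal) : EReal :=
  open Classical in if a = ⊤ ∨ b = ⊤ then ⊤ else a + b

/-- Multiplication by a real `t ≥ 0` with the conventions `0 · (+∞) = +∞` and `0 · (-∞) = 0`. -/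
noncomputable def upperSMul (t : ℝ) (a : EReal) : EReal :=
  open Classical in if a = ⊤ then ⊤ else (t : EReal) * a

/-- Convexity of an extended real valued function. -/
def ConvexFun [AddCommGroup E] [Module ℝ E] (f : E → EReal) : Prop :=
  ∀ x y : E, ∀ t ∈ Set.Icc (0 : ℝ) 1,
    f (t • x + (1 - t) • y) ≤ upperAdd (upperSMul t (f x)) (upperSMul (1 - t) (f y))

end Functions

section Interiors

variable {E : Type*} [AddCommGroup E] [Module ℝ E]

/-- The conic hull `⋃_{t ≥ 0} t U`. -/
def cone (U : Set E) : Set E := {z | ∃ t : ℝ, 0 ≤ t ∧ ∃ u ∈ U, z = t • u}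

/-- The translate `U - x`. -/
def shiftSet (U : Set E) (x : E) : Set E := (fun u => u - x) '' U

/-- The algebraic interior of `U`. -/
def core (U : Set E) : Set E := {x | x ∈ U ∧ cone (shiftSet U x) = Set.univ}

/-- The quasi interior of `U`. -/
def qi [TopologicalSpace E] (U : Set E) : Set E :=
  {x | x ∈ U ∧ closure (cone (shiftSet U x)) = Set.univ}

/-- The quasi-relative interior of `U`: the points `x` of `U` at which the closure of the conic
hull of `U - x` is a linear subspace. -/
def qri [TopologicalSpace E] (U : Set E) : Set E :=
  {x | x ∈ U ∧ ∃ L : Submodule ℝ E, (L : Set E) = closure (cone (shiftSet U x))}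

end Interiors

section Perturbation

variable {X Y : Type*} [AddCommGroup X] [Module ℝ X] [UniformSpace X]
  [AddCommGroup Y] [Module ℝ Y] [UniformSpace Y]

/-- The optimal objective value `v(P_Φ) = inf_x Φ(x, 0)` of the primal problem. -/
noncomputable def primalValue {X Y : Type*} [AddCommGroup Y] (Φ : X × Y → EReal) : EReal :=
  ⨅ x : X, Φ (x, 0)

/-- The projection onto `Y` of the domain of `Φ`. -/
def prDom {X Y : Type*} (Φ : X × Y → EReal) : Set Y := Prod.snd '' dom Φ

/-- The projection onto `Y × ℝ` of the epigraph of a function on `X × Y`. -/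
def prEpi {X Y : Type*} (Φ : X × Y → EReal) : Set (Y × ℝ) :=
  (fun p : (X × Y) × ℝ => (p.1.2, p.2)) '' epi Φ

/-- The convex hull of `pr_{Y × ℝ} (epi (Φ - v(P_Φ))) ∪ {(0, 0)}`. -/
noncomputable def hullEpi {X Y : Type*} [AddCommGroup Y] [Module ℝ Y] (Φ : X × Y → EReal) :
    Set (Y × ℝ) :=
  convexHull ℝ (prEpi (fun p => Φ p - primalValue Φ) ∪ {((0 : Y), (0 : ℝ))})

/-- Continuity of some partial function `Φ(x', ·)` at `0`. -/
def RC1 {X Y : Type*} [AddCommGroup Y] [TopologicalSpace Y] (Φ : X × Y → EReal) : Prop :=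
  ∃ x' : X, (x', (0 : Y)) ∈ dom Φ ∧ ContinuousAt (fun y : Y => Φ (x', y)) 0

/-- The interior condition. -/
def RC2 (Φ : X × Y → EReal) : Prop :=
  FrechetSpace X ∧ FrechetSpace Y ∧ LowerSemicontinuous Φ ∧ (0 : Y) ∈ interior (prDom Φ)

/-- The core condition. -/
def RC3 (Φ : X × Y → EReal) : Prop :=
  FrechetSpace X ∧ FrechetSpace Y ∧ LowerSemicontinuous Φ ∧ (0 : Y) ∈ core (prDom Φ)

/-- The quasi interior condition. -/
def RC6 {X Y : Type*} [AddCommGroup Y] [Module ℝ Y] [TopologicalSpace Y]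
    (Φ : X × Y → EReal) : Prop :=
  (0 : Y) ∈ qi (prDom Φ) ∧ ((0 : Y), (0 : ℝ)) ∉ qri (hullEpi Φ)

/-- The quasi-relative interior condition. -/
def RC7 {X Y : Type*} [AddCommGroup Y] [Module ℝ Y] [TopologicalSpace Y]
    (Φ : X × Y → EReal) : Prop :=
  (0 : Y) ∈ qi (prDom Φ - prDom Φ) ∧ (0 : Y) ∈ qri (prDom Φ) ∧
    ((0 : Y), (0 : ℝ)) ∉ qri (hullEpi Φ)

end Perturbation

end ConvexDuality

namespace ConvexDuality

open Filter Topology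

/-! Everything rests on one fact: if `0` is in the core of `prDom Φ`, the value function `y ↦ inf_x
Φ(x, y)` is bounded above near `0` (`exists_eventually_le_of_zero_mem_core`). The epigraph of `Φ` is
a closed convex relation between `X × ℝ` and `Y` with absorbing range, so Ursescu's theorem applies:
Baire category makes closures of images neighbourhoods of `0`, and completeness removes the closure
by successive approximation. The bound puts a neighbourhood of `0` inside `prDom Φ`, so core gives
interior. It also gives the projected shifted epigraph an interior, which omits the origin when the
primal value is finite; a separating functional is then nonpositive on the hull and negative
somewhere, so the closed cone of the hull is no subspace. RC6 and RC7 are equivalent by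
`zero_mem_qi_iff_sub`, which needs no convexity. -/

/-! ### Ursescu's theorem -/

/-- In a Baire topological vector space, a closed convex absorbing set is a neighbourhood of `0`. -/
theorem mem_nhds_zero_of_isClosed_convex_absorbing {Y : Type*} [AddCommGroup Y] [Module ℝ Y]
    [TopologicalSpace Y] [IsTopologicalAddGroup Y] [ContinuousSMul ℝ Y] [BaireSpace Y] {K : Set Y}
    (hcl : IsClosed K) (hK : Convex ℝ K) (habs : ∀ y : Y, ∃ t : ℝ, 0 < t ∧ t • y ∈ K) :
    K ∈ 𝓝 0 := by
  have h0 : (0 : Y) ∈ K := by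
    obtain ⟨t, -, ht⟩ := habs 0
    simpa using ht
  have hcov : ⋃ n : ℕ, (fun y : Y => ((n : ℝ) + 1)⁻¹ • y) ⁻¹' K = Set.univ := by
    refine Set.eq_univ_of_forall fun y => Set.mem_iUnion.2 ?_
    obtain ⟨t, ht, hty⟩ := habs y
    obtain ⟨n, hn⟩ := exists_nat_one_div_lt ht
    refine ⟨n, ?_⟩
    have hn' : ((n : ℝ) + 1)⁻¹ < t := by simpa [one_div] using hn
    have h := hK.smul_mem_of_zero_mem h0 hty (t := ((n : ℝ) + 1)⁻¹ / t)
      ⟨by positivity, by rw [div_le_one ht]; exact hn'.le⟩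
    rw [smul_smul, div_mul_cancel₀ _ ht.ne'] at h
    exact h
  -- By Baire, some dilate of `K` has interior, hence so does `K`.
  obtain ⟨n, z, hz⟩ := nonempty_interior_of_iUnion_of_closed
    (fun n : ℕ => hcl.preimage (continuous_const_smul ((n : ℝ) + 1)⁻¹)) hcov
  have hc : ((n : ℝ) + 1)⁻¹ ≠ 0 := by positivity
  have hw : ((n : ℝ) + 1)⁻¹ • z ∈ interior K := by
    rw [mem_interior_iff_mem_nhds] at hz ⊢
    have := (Homeomorph.smulOfNeZero _ hc).map_nhds_eq z
    simp only [Homeomorph.smulOfNeZero_apply] at this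
    rw [← this]
    exact hz
  set w := ((n : ℝ) + 1)⁻¹ • z
  obtain ⟨t, ht, htw⟩ := habs (-w)
  -- The weights make `w` and `t • (-w)` cancel, so `0` is interior.
  have := hK.combo_interior_self_mem_interior hw htw (a := t / (1 + t)) (b := 1 / (1 + t))
    (by positivity) (by positivity) (by field_simp; ring)
  rw [mem_interior_iff_mem_nhds] at this
  convert this using 2
  module

/-- A small positive multiple of any vector lies in a given neighbourhood of `0`. -/
theorem exists_pos_le_one_smul_mem {E : Type*} [AddCommGroup E] [Module ℝ E]
    [TopologicalSpace E] [ContinuousSMul ℝ E] {U : Set E} (hU : U ∈ 𝓝 0) (x : E) :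
    ∃ s : ℝ, 0 < s ∧ s ≤ 1 ∧ s • x ∈ U := by
  have h : Tendsto (fun s : ℝ => s • x) (𝓝[>] 0) (𝓝 0) := by
    have : Tendsto (fun s : ℝ => s • x) (𝓝 0) (𝓝 ((0 : ℝ) • x)) :=
      (continuous_id.smul continuous_const).tendsto 0
    rw [zero_smul] at this
    exact this.mono_left nhdsWithin_le_nhds
  have h1 : ∀ᶠ s : ℝ in 𝓝[>] 0, s ∈ Set.Ioc (0 : ℝ) 1 := Ioc_mem_nhdsGT one_pos
  obtain ⟨s, hs, hs1⟩ := ((h.eventually hU).and h1).exists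
  exact ⟨s, hs1.1, hs1.2, hs⟩

/-- If the increments of a sequence lie in a sequence of neighbourhoods which is summable in the
sense `U (n + 1) + U (n + 1) ⊆ U n`, then the tails lie in these neighbourhoods. -/
theorem sub_mem_of_increments_mem {X : Type*} [AddCommGroup X] {U : ℕ → Set X} {s : ℕ → X}
    (h0 : ∀ n, (0 : X) ∈ U n) (hU : ∀ n, U (n + 1) + U (n + 1) ⊆ U n)
    (hs : ∀ n, s (n + 1) - s n ∈ U (n + 1)) (j m : ℕ) : s (m + j) - s m ∈ U m := by
  induction j generalizing m with
  | zero => simpa using h0 m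
  | succ j ih =>
    refine hU m ⟨_, hs m, _, ih (m + 1), ?_⟩
    rw [show m + 1 + j = m + (j + 1) by omega]
    simp

/-- The Ursescu theorem for a closed convex relation `C` between a Fréchet space and a Baire
metrizable space: if the range of `C` is absorbing, then `C` maps neighbourhoods of `0` to
neighbourhoods of `0`. -/
theorem image_nhds_zero_mem_nhds_zero {X Y : Type*}
    [AddCommGroup X] [Module ℝ X] [UniformSpace X] [IsUniformAddGroup X] [ContinuousSMul ℝ X]
    [LocallyConvexSpace ℝ X] [CompleteSpace X] [FirstCountableTopology X]
    [AddCommGroup Y] [Module ℝ Y] [TopologicalSpace Y] [IsTopologicalAddGroup Y]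
    [ContinuousSMul ℝ Y] [BaireSpace Y] [FirstCountableTopology Y] {C : Set (X × Y)}
    (hcl : IsClosed C) (hC : Convex ℝ C) (h0 : (0 : X × Y) ∈ C)
    (habs : ∀ y : Y, ∃ t : ℝ, 0 < t ∧ ∃ x, (x, t • y) ∈ C) {N : Set X} (hN : N ∈ 𝓝 0) :
    {y : Y | ∃ x ∈ N, (x, y) ∈ C} ∈ 𝓝 0 := by
  obtain ⟨u, hu, hadd⟩ := IsTopologicalAddGroup.exists_antitone_basis_nhds_zero X
  obtain ⟨V, hV⟩ := (𝓝 (0 : Y)).exists_antitone_basis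
  obtain ⟨N', ⟨hN'mem, hN'cl⟩, hN'N⟩ := (closed_nhds_basis (0 : X)).mem_iff.1 hN
  obtain ⟨n₀, hn₀⟩ := hu.mem_iff.1 hN'mem
  set U : ℕ → Set X := fun n => u (n₀ + n) with hUdef
  have hU : ∀ n, U n ∈ 𝓝 (0 : X) := fun n => hu.mem _
  have hUadd : ∀ n, U (n + 1) + U (n + 1) ⊆ U n := fun n => hadd (n₀ + n)
  have hWex : ∀ n, ∃ W : Set X, (W ∈ 𝓝 (0 : X) ∧ Convex ℝ W) ∧ W ⊆ U (n + 1) := fun n =>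
    (LocallyConvexSpace.convex_basis_zero ℝ X).mem_iff.1 (hU (n + 1))
  choose W hW hWU using hWex
  set K : ℕ → Set Y := fun n => closure {y : Y | ∃ x ∈ W n, (x, y) ∈ C} with hKdef
  have hK : ∀ n, K n ∈ 𝓝 (0 : Y) := by
    intro n
    refine mem_nhds_zero_of_isClosed_convex_absorbing isClosed_closure (Convex.closure ?_) ?_
    · rintro y ⟨x, hx, hxy⟩ y' ⟨x', hx', hxy'⟩ a b ha hb hab
      exact ⟨a • x + b • x', (hW n).2 hx hx' ha hb hab, hC hxy hxy' ha hb hab⟩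
    · intro y
      obtain ⟨t, ht, x, hx⟩ := habs y
      obtain ⟨s, hs, hs1, hsx⟩ := exists_pos_le_one_smul_mem (hW n).1 x
      refine ⟨s * t, by positivity, subset_closure ⟨s • x, hsx, ?_⟩⟩
      have := hC.smul_mem_of_zero_mem h0 hx ⟨hs.le, hs1⟩
      rwa [Prod.smul_mk, smul_smul] at this
  have htwo : ∀ n, {z : Y | (2 : ℝ) • z ∈ K n} ∈ 𝓝 (0 : Y) := by
    intro n
    have : Tendsto (fun z : Y => (2 : ℝ) • z) (𝓝 0) (𝓝 0) := by
      simpa using (continuous_const_smul (2 : ℝ)).tendsto (0 : Y)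
    exact this (hK n)
  -- Newton-like step: a point of the image of `W n` is chosen so close to `2r` that the new
  -- residual satisfies the same condition at level `n + 1`. The default `0` only makes the choice
  -- total.
  have hstep : ∀ (n : ℕ) (r : Y), ∃ p : X × Y, (2 : ℝ) • r ∈ K n →
      p.1 ∈ W n ∧ p ∈ C ∧ (2 : ℝ) • ((2 : ℝ) • r - p.2) ∈ K (n + 1) ∧
        (2 : ℝ) • r - p.2 ∈ V n := by
    intro n r
    by_cases hr : (2 : ℝ) • r ∈ K n
    · have hnhds : {z : Y | -z ∈ {z : Y | (2 : ℝ) • z ∈ K (n + 1)} ∩ V n} ∈ 𝓝 (0 : Y) := by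
        have : Tendsto (fun z : Y => -z) (𝓝 0) (𝓝 0) := by
          simpa using (continuous_neg).tendsto (0 : Y)
        exact this (inter_mem (htwo (n + 1)) (hV.mem n))
      obtain ⟨y, ⟨x, hx, hxy⟩, hy⟩ := mem_closure_iff_nhds_zero.1 hr _ hnhds
      simp only [Set.mem_ofPred_eq, neg_sub] at hy
      exact ⟨(x, y), fun _ => ⟨hx, hxy, hy.1, hy.2⟩⟩
    · exact ⟨0, fun h => absurd h hr⟩
  choose p hp using hstep
  refine mem_of_superset (htwo 0) fun y hy => ?_
  -- Rescaled residuals: `y` minus the first `n` terms `2⁻ᵏ⁻¹ (p k (r k)).2` equals `2⁻ⁿ r n`.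
  let r : ℕ → Y := fun n => Nat.rec y (fun k z => (2 : ℝ) • z - (p k z).2) n
  have hr0 : r 0 = y := rfl
  have hrs : ∀ n, r (n + 1) = (2 : ℝ) • r n - (p n (r n)).2 := fun n => rfl
  have hrK : ∀ n, (2 : ℝ) • r n ∈ K n := by
    intro n
    induction n with
    | zero => exact hy
    | succ n ih => rw [hrs]; exact (hp n (r n) ih).2.2.1
  let s : ℕ → X := fun n => ∑ k ∈ Finset.range n, ((1 : ℝ) / 2) ^ (k + 1) • (p k (r k)).1
  have hinc : ∀ n, s (n + 1) - s n ∈ U (n + 1) := by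
    intro n
    simp only [s, Finset.sum_range_succ, add_sub_cancel_left]
    exact hWU n ((hW n).2.smul_mem_of_zero_mem (mem_of_mem_nhds (hW n).1) (hp n (r n) (hrK n)).1
      ⟨by positivity, pow_le_one₀ (by norm_num) (by norm_num)⟩)
  have htail := sub_mem_of_increments_mem (fun n => mem_of_mem_nhds (hU n)) hUadd hinc
  -- The weights used so far sum to `1 - 2⁻ⁿ`; an arbitrary `q ∈ C` carries the rest, which lets the
  -- induction split it in halves. Finally `q = 0`.
  have hmemC : ∀ n, ∀ q ∈ C, (s n + ((1 : ℝ) / 2) ^ n • q.1,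
      y - ((1 : ℝ) / 2) ^ n • r n + ((1 : ℝ) / 2) ^ n • q.2) ∈ C := by
    intro n
    induction n with
    | zero => intro q hq; simpa [s, hr0] using hq
    | succ n ih =>
      intro q hq
      have h := ih _ (hC (hp n (r n) (hrK n)).2.1 hq (by norm_num : (0 : ℝ) ≤ 1 / 2)
        (by norm_num : (0 : ℝ) ≤ 1 / 2) (by norm_num))
      convert h using 2
      · simp only [s, Finset.sum_range_succ, Prod.fst_add, Prod.smul_fst]
        module
      · simp only [hrs, Prod.snd_add, Prod.smul_snd]
        module
  have hcau : CauchySeq s := by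
    have hb : (uniformity X).HasBasis (fun _ : ℕ => True)
        (fun n => (fun x : X × X => x.2 - x.1) ⁻¹' ((fun x => -x) ⁻¹' U n)) := by
      rw [uniformity_eq_comap_nhds_zero X]
      refine HasBasis.comap _ ?_
      have h1 : (𝓝 (0 : X)).HasBasis (fun _ : ℕ => True) U :=
        hu.toHasBasis.to_hasBasis
          (fun n _ => ⟨n, trivial, hu.antitone (by omega)⟩) (fun n _ => ⟨n₀ + n, trivial, subset_rfl⟩)
      have h2 := h1.comap (fun x : X => -x)
      rwa [show comap (fun x : X => -x) (𝓝 0) = 𝓝 0 by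
        simpa using (Homeomorph.neg X).comap_nhds_eq 0] at h2
    rw [hb.cauchySeq_iff']
    intro n _
    refine ⟨n, fun m hm => ?_⟩
    obtain ⟨j, rfl⟩ := Nat.exists_eq_add_of_le hm
    simpa using htail j n
  obtain ⟨x, hx⟩ := cauchySeq_tendsto_of_complete hcau
  have hrlim : Tendsto r atTop (𝓝 0) := by
    rw [← tendsto_add_atTop_iff_nat 1]
    exact hV.tendsto fun n => (hp n (r n) (hrK n)).2.2.2
  have hylim : Tendsto (fun n => y - ((1 : ℝ) / 2) ^ n • r n) atTop (𝓝 y) := by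
    have h1 : Tendsto (fun n : ℕ => ((1 : ℝ) / 2) ^ n) atTop (𝓝 0) :=
      tendsto_pow_atTop_nhds_zero_of_lt_one (by norm_num) (by norm_num)
    simpa using tendsto_const_nhds.sub (h1.smul hrlim)
  refine ⟨x, hN'N (hN'cl.mem_of_tendsto hx (Eventually.of_forall fun n => hn₀ ?_)),
    hcl.mem_of_tendsto (hx.prodMk_nhds hylim) (Eventually.of_forall fun n => ?_)⟩
  · simpa [s, hUdef] using htail n 0
  · simpa using hmemC n 0 h0


/-! ### Cones and generalized interiors at the origin -/

theorem shiftSet_zero {E : Type*} [AddCommGroup E] (U : Set E) : shiftSet U 0 = U := by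
  simp [shiftSet]

theorem cone_mono {E : Type*} [AddCommGroup E] [Module ℝ E] {U V : Set E} (h : U ⊆ V) :
    cone U ⊆ cone V := by
  rintro _ ⟨t, ht, u, hu, rfl⟩
  exact ⟨t, ht, u, h hu, rfl⟩

theorem subset_cone {E : Type*} [AddCommGroup E] [Module ℝ E] (U : Set E) : U ⊆ cone U :=
  fun u hu => ⟨1, zero_le_one, u, hu, (one_smul ℝ u).symm⟩

theorem zero_mem_qi_iff {E : Type*} [AddCommGroup E] [Module ℝ E] [TopologicalSpace E]
    {U : Set E} : (0 : E) ∈ qi U ↔ 0 ∈ U ∧ closure (cone U) = Set.univ := by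
  simp only [qi, Set.mem_ofPred_eq, shiftSet_zero]

theorem zero_mem_qri_iff {E : Type*} [AddCommGroup E] [Module ℝ E] [TopologicalSpace E]
    {U : Set E} :
    (0 : E) ∈ qri U ↔ 0 ∈ U ∧ ∃ L : Submodule ℝ E, (L : Set E) = closure (cone U) := by
  simp only [qri, Set.mem_ofPred_eq, shiftSet_zero]

theorem zero_mem_core_iff {E : Type*} [AddCommGroup E] [Module ℝ E] {U : Set E} :
    (0 : E) ∈ core U ↔ 0 ∈ U ∧ cone U = Set.univ := by
  simp only [core, Set.mem_ofPred_eq, shiftSet_zero]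

/-- The origin is a quasi interior point of `U` iff it is a quasi-relative interior point of `U`
and a quasi interior point of `U - U`. -/
theorem zero_mem_qi_iff_sub {E : Type*} [AddCommGroup E] [Module ℝ E] [TopologicalSpace E]
    {U : Set E} : (0 : E) ∈ qi U ↔ (0 : E) ∈ qi (U - U) ∧ (0 : E) ∈ qri U := by
  rw [zero_mem_qi_iff, zero_mem_qi_iff, zero_mem_qri_iff]
  constructor
  · rintro ⟨h0, h⟩
    refine ⟨⟨⟨0, h0, 0, h0, sub_zero 0⟩, ?_⟩, h0, ⊤, by simp [h]⟩
    refine Set.univ_subset_iff.1 (h.symm.subset.trans (closure_mono (cone_mono ?_)))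
    exact fun u hu => ⟨u, hu, 0, h0, sub_zero u⟩
  · rintro ⟨⟨-, h⟩, h0, L, hL⟩
    refine ⟨h0, Set.univ_subset_iff.1 (h.symm.subset.trans ?_)⟩
    refine closure_minimal ?_ isClosed_closure
    rw [← hL]
    rintro _ ⟨t, -, _, ⟨u, hu, w, hw, rfl⟩, rfl⟩
    -- A subspace containing `U` contains `U - U` and its cone.
    have hUL : U ⊆ L := by
      rw [hL]
      exact (subset_cone U).trans subset_closure
    exact L.smul_mem t (L.sub_mem (hUL hu) (hUL hw))

theorem zero_mem_qi_of_mem_core {E : Type*} [AddCommGroup E] [Module ℝ E] [TopologicalSpace E]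
    {U : Set E} (h : (0 : E) ∈ core U) : (0 : E) ∈ qi U := by
  rw [zero_mem_core_iff] at h
  rw [zero_mem_qi_iff, h.2, closure_univ]
  exact ⟨h.1, rfl⟩

theorem exists_pos_smul_mem_of_zero_mem_core {E : Type*} [AddCommGroup E] [Module ℝ E]
    {U : Set E} (h : (0 : E) ∈ core U) (y : E) : ∃ t : ℝ, 0 < t ∧ t • y ∈ U := by
  rw [zero_mem_core_iff] at h
  obtain ⟨t, ht, u, hu, rfl⟩ : y ∈ cone U := h.2 ▸ Set.mem_univ y
  rcases ht.eq_or_lt with rfl | ht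
  · exact ⟨1, one_pos, by simpa using h.1⟩
  · exact ⟨t⁻¹, inv_pos.2 ht, by rwa [inv_smul_smul₀ ht.ne']⟩

theorem zero_mem_core_of_mem_nhds {E : Type*} [AddCommGroup E] [Module ℝ E] [TopologicalSpace E]
    [ContinuousSMul ℝ E] {U : Set E} (h : U ∈ 𝓝 0) : (0 : E) ∈ core U := by
  rw [zero_mem_core_iff]
  refine ⟨mem_of_mem_nhds h, Set.eq_univ_of_forall fun y => ?_⟩
  obtain ⟨s, hs, -, hsy⟩ := exists_pos_le_one_smul_mem h y
  exact ⟨s⁻¹, (inv_pos.2 hs).le, _, hsy, by rw [inv_smul_smul₀ hs.ne']⟩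

/-- A set lying in a closed half space whose closed conic hull is a subspace lies in the bounding
hyperplane. -/
theorem eq_zero_of_zero_mem_qri {E : Type*} [AddCommGroup E] [Module ℝ E] [TopologicalSpace E]
    {U : Set E} (h : (0 : E) ∈ qri U) (f : E →L[ℝ] ℝ) (hf : ∀ u ∈ U, f u ≤ 0) {u : E}
    (hu : u ∈ U) : f u = 0 := by
  obtain ⟨-, L, hL⟩ := zero_mem_qri_iff.1 h
  have hle : ∀ z ∈ L, f z ≤ 0 := by
    intro z hz
    have hz' : z ∈ closure (cone U) := hL ▸ hz
    refine closure_minimal ?_ (isClosed_le f.continuous continuous_const) hz'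
    rintro _ ⟨t, ht, w, hw, rfl⟩
    simpa using mul_nonpos_of_nonneg_of_nonpos ht (hf w hw)
  have huL : u ∈ L := by
    have : u ∈ (L : Set E) := hL ▸ subset_closure (subset_cone U hu)
    exact this
  have := hle _ (L.neg_mem huL)
  rw [map_neg] at this
  linarith [hf u hu]

/-! ### Epigraphs and the value function -/

/-- The epigraph of a convex function which does not take the value `-∞` is convex. -/
theorem convex_epi {E : Type*} [AddCommGroup E] [Module ℝ E] {f : E → EReal}
    (hbot : ∀ x, ⊥ < f x) (hf : ConvexFun f) : Convex ℝ (epi f) := by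
  rintro ⟨x, r⟩ hx ⟨y, s⟩ hy a b ha hb hab
  have hfin : ∀ z (c : ℝ), f z ≤ c → ∃ d : ℝ, f z = d ∧ d ≤ c := by
    intro z c hz
    lift f z to ℝ using ⟨(hz.trans_lt (EReal.coe_lt_top c)).ne, (hbot z).ne'⟩ with d
    exact ⟨d, rfl, EReal.coe_le_coe_iff.1 hz⟩
  obtain ⟨r', hr', hrr⟩ := hfin x r hx
  obtain ⟨s', hs', hss⟩ := hfin y s hy
  have hb' : b = 1 - a := by linarith
  have h := hf x y a ⟨ha, by linarith⟩
  rw [← hb', hr', hs'] at h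
  simp only [upperSMul, upperAdd, EReal.coe_ne_top, if_false, ← EReal.coe_mul, or_self,
    ← EReal.coe_add] at h
  refine h.trans (EReal.coe_le_coe_iff.2 ?_)
  change a * r' + b * s' ≤ a * r + b * s
  gcongr

theorem isClosed_epi {E : Type*} [TopologicalSpace E] {f : E → EReal}
    (hf : LowerSemicontinuous f) : IsClosed (epi f) :=
  hf.isClosed_epigraph.preimage
    (continuous_fst.prodMk (continuous_coe_real_ereal.comp continuous_snd))

/-- If the origin is in the core of `prDom Φ`, then the value function `y ↦ inf_x Φ(x, y)` is
bounded above on a neighbourhood of the origin. -/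
theorem exists_eventually_le_of_zero_mem_core {X Y : Type*}
    [AddCommGroup X] [Module ℝ X] [UniformSpace X] [FrechetSpace X]
    [AddCommGroup Y] [Module ℝ Y] [UniformSpace Y] [FrechetSpace Y]
    {Φ : X × Y → EReal} (hbot : ∀ p, ⊥ < Φ p) (hconv : ConvexFun Φ)
    (hlsc : LowerSemicontinuous Φ) (hcore : (0 : Y) ∈ core (prDom Φ)) :
    ∃ M : ℝ, ∀ᶠ y in 𝓝 (0 : Y), ∃ x, Φ (x, y) ≤ M := by
  -- Together with completeness, this makes `Y` a Baire space.
  have := IsUniformAddGroup.uniformity_countably_generated (α := Y)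
  have hdom : ∀ {y : Y}, y ∈ prDom Φ → ∃ x, ∃ r : ℝ, Φ (x, y) ≤ r := by
    rintro _ ⟨⟨x, y⟩, hxy, rfl⟩
    obtain ⟨r, hr, -⟩ := EReal.lt_iff_exists_real_btwn.1 hxy
    exact ⟨x, r, hr.le⟩
  obtain ⟨x₀, r₀, h₀⟩ := hdom hcore.1
  -- Moves the epigraph point `((x₀, 0), r₀)` to the origin and groups the height with `X`, so that
  -- a neighbourhood of `0` in `X × ℝ` can bound it.
  let g : (X × ℝ) × Y → (X × Y) × ℝ := fun q => ((x₀ + q.1.1, q.2), r₀ + q.1.2)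
  have hg : Continuous g := by fun_prop
  have hC : Convex ℝ (g ⁻¹' epi Φ) := by
    intro p hp q hq a b ha hb hab
    have h := convex_epi hbot hconv hp hq ha hb hab
    rw [Set.mem_preimage]
    convert h using 1
    obtain rfl : b = 1 - a := by linarith
    refine Prod.ext (Prod.ext ?_ ?_) ?_
    · simp only [g, Prod.fst_add, Prod.smul_fst]
      module
    · simp [g]
    · simp [g]
      ring
  have hN : {q : X × ℝ | q.2 ≤ 1} ∈ 𝓝 (0 : X × ℝ) :=
    continuous_snd.continuousAt.eventually (Iic_mem_nhds (by simp))
  have key := image_nhds_zero_mem_nhds_zero ((isClosed_epi hlsc).preimage hg) hC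
    (by simpa [g, epi] using h₀) (fun y => ?_) hN
  · refine ⟨r₀ + 1, mem_of_superset key ?_⟩
    rintro y ⟨⟨x, r⟩, hr, hxy⟩
    refine ⟨x₀ + x, le_trans (show Φ (x₀ + x, y) ≤ ((r₀ + r : ℝ) : EReal) from hxy) ?_⟩
    exact EReal.coe_le_coe_iff.2 (add_le_add_right hr r₀)
  · obtain ⟨t, ht, hty⟩ := exists_pos_smul_mem_of_zero_mem_core hcore y
    obtain ⟨x, r, hx⟩ := hdom hty
    exact ⟨t, ht, (x - x₀, r - r₀), by simpa [g, epi, ← EReal.coe_sub, ← EReal.coe_add] using hx⟩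

/-- If the value function is bounded above near the origin and its value there is finite, then
the origin is not a quasi-relative interior point of `hullEpi Φ`. -/
theorem zero_notMem_qri_hullEpi {X Y : Type*} [AddCommGroup X] [Module ℝ X]
    [AddCommGroup Y] [Module ℝ Y] [TopologicalSpace Y] [IsTopologicalAddGroup Y]
    [ContinuousSMul ℝ Y] {Φ : X × Y → EReal} (hbot : ∀ p, ⊥ < Φ p) (hconv : ConvexFun Φ)
    (hv : ⊥ < primalValue Φ) {M : ℝ} (hM : ∀ᶠ y in 𝓝 (0 : Y), ∃ x, Φ (x, y) ≤ M) :
    ((0 : Y), (0 : ℝ)) ∉ qri (hullEpi Φ) := by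
  obtain ⟨x₀, hx₀⟩ := hM.self_of_nhds
  obtain ⟨c, hc⟩ : ∃ c : ℝ, primalValue Φ = c := by
    lift primalValue Φ to ℝ using
      ⟨((iInf_le _ x₀).trans_lt (hx₀.trans_lt (EReal.coe_lt_top M))).ne, hv.ne'⟩ with c
    exact ⟨c, rfl⟩
  set P : Set (Y × ℝ) := prEpi (fun p => Φ p - primalValue Φ) with hP
  have hmem : ∀ y r, (y, r) ∈ P ↔ ∃ x, Φ (x, y) ≤ ((r + c : ℝ) : EReal) := by
    intro y r
    have hsub : ∀ x, Φ (x, y) - primalValue Φ ≤ (r : EReal) ↔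
        Φ (x, y) ≤ ((r + c : ℝ) : EReal) := by
      intro x
      rw [hc, EReal.coe_add]
      exact EReal.sub_le_iff_le_add (Or.inl (EReal.coe_ne_bot c)) (Or.inl (EReal.coe_ne_top c))
    constructor
    · rintro ⟨⟨⟨x, y'⟩, r'⟩, h, he⟩
      obtain ⟨rfl, rfl⟩ := Prod.ext_iff.1 he
      exact ⟨x, (hsub x).1 h⟩
    · rintro ⟨x, h⟩
      exact ⟨((x, y), r), (hsub x).2 h, rfl⟩
  have hPconv : Convex ℝ P := by
    rintro ⟨y, r⟩ hy ⟨y', r'⟩ hy' a b ha hb hab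
    obtain ⟨x, hx⟩ := (hmem _ _).1 hy
    obtain ⟨x', hx'⟩ := (hmem _ _).1 hy'
    refine (hmem _ _).2 ⟨a • x + b • x', ?_⟩
    have h : Φ (a • (x, y) + b • (x', y')) ≤ ((a • (r + c) + b • (r' + c) : ℝ) : EReal) :=
      convex_epi hbot hconv (x := ((x, y), r + c)) hx (y := ((x', y'), r' + c)) hx' ha hb hab
    have e : a • (r + c) + b • (r' + c) = a * r + b * r' + c := by
      simp only [smul_eq_mul]
      linear_combination c * hab
    rw [e] at h
    exact h
  have hint : ((0 : Y), M - c + 1) ∈ interior P := by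
    rw [mem_interior_iff_mem_nhds, nhds_prod_eq]
    filter_upwards [hM.prod_mk (Ici_mem_nhds (show M - c < M - c + 1 by linarith))]
      with ⟨y, r⟩ ⟨⟨x, hx⟩, hr⟩
    refine (hmem y r).2 ⟨x, hx.trans (EReal.coe_le_coe_iff.2 ?_)⟩
    have : M - c ≤ r := hr
    linarith
  -- Otherwise some `(0, -s)` with `s > 0` lies in `P`, giving a primal value below its infimum `c`.
  have hzero : (0 : Y × ℝ) ∉ interior P := by
    intro h
    rw [mem_interior_iff_mem_nhds] at h
    obtain ⟨s, hs, -, hsP⟩ := exists_pos_le_one_smul_mem h ((0 : Y), (-1 : ℝ))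
    obtain ⟨x, hx⟩ := (hmem (s • (0 : Y)) (s • (-1 : ℝ))).1 hsP
    rw [smul_zero] at hx
    have h1 : (c : EReal) ≤ ((s • (-1 : ℝ) + c : ℝ) : EReal) := hc ▸ (iInf_le _ x).trans hx
    rw [EReal.coe_le_coe_iff, smul_eq_mul] at h1
    linarith
  obtain ⟨f, hf⟩ := geometric_hahn_banach_open_point hPconv.interior isOpen_interior hzero
  simp only [map_zero] at hf
  have hfP : P ⊆ {z | f z ≤ 0} := by
    intro z hz
    have hcl : z ∈ closure (interior P) := by
      rw [hPconv.closure_interior_eq_closure_of_nonempty_interior ⟨_, hint⟩]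
      exact subset_closure hz
    exact closure_minimal (fun w hw => (hf w hw).le) (isClosed_le f.continuous continuous_const) hcl
  have hfH : ∀ u ∈ hullEpi Φ, f u ≤ 0 := by
    refine convexHull_min (Set.union_subset hfP ?_) (convex_halfSpace_le f.isLinear 0)
    rintro _ rfl
    exact (map_zero f).le
  intro hq
  -- `f` would vanish on the whole hull, yet it is negative at the interior point of `P`.
  refine (hf _ hint).ne (eq_zero_of_zero_mem_qri hq f hfH (subset_convexHull ℝ _ (Or.inl ?_)))
  exact interior_subset hint

theorem RC1.rc2 {X Y : Type*} [AddCommGroup X] [Module ℝ X] [UniformSpace X] [FrechetSpace X]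
    [AddCommGroup Y] [Module ℝ Y] [UniformSpace Y] [FrechetSpace Y] {Φ : X × Y → EReal}
    (hlsc : LowerSemicontinuous Φ) (h : RC1 Φ) : RC2 Φ := by
  obtain ⟨x', hx', hcont⟩ := h
  refine ⟨inferInstance, inferInstance, hlsc, mem_interior_iff_mem_nhds.2 ?_⟩
  filter_upwards [hcont.eventually (Iio_mem_nhds hx')] with y hy
  exact ⟨(x', y), hy, rfl⟩

end ConvexDuality

theorem proposition4p5 {X Y : Type*}
    [AddCommGroup X] [Module ℝ X] [UniformSpace X] [ConvexDuality.FrechetSpace X]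
    [AddCommGroup Y] [Module ℝ Y] [UniformSpace Y] [ConvexDuality.FrechetSpace Y]
    (Φ : X × Y → EReal) (hproper : ConvexDuality.Proper Φ) (hconv : ConvexDuality.ConvexFun Φ)
    (hlsc : LowerSemicontinuous Φ) :
    (ConvexDuality.RC1 Φ → ConvexDuality.RC2 Φ) ∧
    (ConvexDuality.RC2 Φ ↔ ConvexDuality.RC3 Φ) ∧
    (⊥ < ConvexDuality.primalValue Φ →
      (ConvexDuality.RC3 Φ → ConvexDuality.RC6 Φ) ∧
      (ConvexDuality.RC6 Φ ↔ ConvexDuality.RC7 Φ)) := by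
  refine ⟨ConvexDuality.RC1.rc2 hlsc, ⟨?_, ?_⟩, fun hv => ⟨?_, ?_⟩⟩
  · rintro ⟨hX, hY, hl, h⟩
    exact ⟨hX, hY, hl, ConvexDuality.zero_mem_core_of_mem_nhds (mem_interior_iff_mem_nhds.1 h)⟩
  · rintro ⟨hX, hY, hl, h⟩
    obtain ⟨M, hM⟩ :=
      ConvexDuality.exists_eventually_le_of_zero_mem_core hproper.2 hconv hlsc h
    refine ⟨hX, hY, hl, mem_interior_iff_mem_nhds.2 ?_⟩
    filter_upwards [hM] with y ⟨x, hx⟩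
    exact ⟨(x, y), hx.trans_lt (EReal.coe_lt_top M), rfl⟩
  · rintro ⟨-, -, -, h⟩
    obtain ⟨M, hM⟩ :=
      ConvexDuality.exists_eventually_le_of_zero_mem_core hproper.2 hconv hlsc h
    exact ⟨ConvexDuality.zero_mem_qi_of_mem_core h,
      ConvexDuality.zero_notMem_qri_hullEpi hproper.2 hconv hv hM⟩
  · rw [ConvexDuality.RC6, ConvexDuality.RC7, ConvexDuality.zero_mem_qi_iff_sub, and_assoc]
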